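/- Let $\mathbb{R}^2_1$ be the Manhattan plane, that is, $\mathbb{R}^2$ with the metric $d_1((x_1,y_1),(x_2,y_2)) = |x_1-x_2| + |y_1-y_2|$. For $A \subseteq \mathbb{R}^2_1$ let $L_x(A)$ be the union, over all $y\in\mathbb{R}$, of the smallest segments (possibly infinite or empty, and not necessarily containing their endpoints, i.e. the convex hulls) containing $\{p\in A : p_2=y\}$, and let $L_y(A)$ be the union, over all $x\in\mathbb{R}$, of the smallest segments containing $\{p\in A: p_1=x\}$. The double hatching of $A$ is $L(A) = L_x(L_y(A))$. The tight span $T(X)$ of a metric space $(X,d)$ is the set of pointwise minimal functions among the functions $f : X \to [0,\infty)$ with $f(x)+f(y) \ge d(x,y)$ for all $x,y\in X$, with the supremum metric $d_\infty(f,g) = \sup_{x\in X} |f(x)-g(x)|$. Let $A \subseteq \mathbb{R}^2_1$ be a nonempty path-connected subset, with the metric induced by $d_1$. Then the closure $\overline{L(A)}$ of the double hatching of $A$ in $\mathbb{R}^2_1$, with the metric induced by $d_1$, is isometric to the tight span $T(A)$ of $A$. -/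

import Mathlib

/-- The Manhattan plane: `ℝ²` with the metric `|x₁ - x₂| + |y₁ - y₂|`. -/
abbrev ManhattanPlane : Type := WithLp 1 (ℝ × ℝ)

/-- Hatching in the `x`-direction: for each horizontal line, the smallest (possibly infinite or
empty) segment containing the part of `A` on that line. -/
def hatchX (A : Set ManhattanPlane) : Set ManhattanPlane :=
  ⋃ y : ℝ, convexHull ℝ {p | p ∈ A ∧ p.snd = y}

/-- Hatching in the `y`-direction: for each vertical line, the smallest (possibly infinite or
empty) segment containing the part of `A` on that line. -/
def hatchY (A : Set ManhattanPlane) : Set ManhattanPlane :=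
  ⋃ x : ℝ, convexHull ℝ {p | p ∈ A ∧ p.fst = x}

/-- The double hatching of `A`. -/
def doubleHatch (A : Set ManhattanPlane) : Set ManhattanPlane :=
  hatchX (hatchY A)

/-- The nonnegative functions `f` on `X` with `f x + f y ≥ d(x, y)` for all `x, y`. -/
def DominatesDist {X : Type*} [MetricSpace X] (f : X → ℝ) : Prop :=
  (∀ x, 0 ≤ f x) ∧ ∀ x y, dist x y ≤ f x + f y

/-- The tight span of a metric space `X`: the pointwise minimal nonnegative functions `f` with
`f x + f y ≥ d(x, y)` for all `x, y`. -/
def TightSpan (X : Type*) [MetricSpace X] : Type _ :=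
  {f : X → ℝ // Minimal DominatesDist f}

namespace TightSpan

variable {X : Type*} [MetricSpace X]

theorem le_dist_add (f : TightSpan X) (x y : X) : f.1 x ≤ dist x y + f.1 y := by
  classical
  by_contra! h
  have hf := f.2.prop
  have hne : ∀ z, z ≠ x → Function.update f.1 x (dist x y + f.1 y) z = f.1 z :=
    fun z hz => Function.update_of_ne hz _ _
  have h0 : 0 ≤ dist x y + f.1 y := add_nonneg dist_nonneg (hf.1 y)
  have key : ∀ z, z ≠ x → dist x z ≤ dist x y + f.1 y + f.1 z := fun z _ => by
    have := dist_triangle x y z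
    have := hf.2 y z
    linarith
  have hg : DominatesDist (Function.update f.1 x (dist x y + f.1 y)) := by
    refine ⟨fun z => ?_, fun z w => ?_⟩
    · by_cases hz : z = x
      · subst hz; simpa using h0
      · rw [hne z hz]; exact hf.1 z
    · by_cases hz : z = x <;> by_cases hw : w = x
      · subst hz; subst hw; simp; linarith
      · subst hz; rw [hne w hw]; simpa using key w hw
      · subst hw; rw [hne z hz, dist_comm]; simpa [add_comm, add_left_comm] using key z hz
      · rw [hne z hz, hne w hw]; exact hf.2 z w
  have hle : Function.update f.1 x (dist x y + f.1 y) ≤ f.1 := by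
    intro z
    by_cases hz : z = x
    · subst hz; simpa using h.le
    · exact (hne z hz).le
  have := f.2.le_of_le hg hle x
  simp at this
  linarith

theorem bddAbove_range_abs_sub (f g : TightSpan X) :
    BddAbove (Set.range fun x => |f.1 x - g.1 x|) := by
  rcases isEmpty_or_nonempty X with hX | ⟨⟨y⟩⟩
  · simp [Set.range_eq_empty]
  · refine ⟨f.1 y + g.1 y, ?_⟩
    rintro _ ⟨x, rfl⟩
    have h1 := f.le_dist_add x y
    have h2 := g.le_dist_add x y
    have h3 := f.2.prop.2 x y
    have h4 := g.2.prop.2 x y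
    exact abs_le.2 ⟨by linarith, by linarith⟩

/-- The tight span carries the supremum metric; the supremum is always over a bounded set. -/
noncomputable instance : MetricSpace (TightSpan X) where
  dist f g := ⨆ x, |f.1 x - g.1 x|
  dist_self f := by simp
  dist_comm f g := by simp only [abs_sub_comm]
  dist_triangle f g h := by
    refine Real.iSup_le (fun x => ?_) (add_nonneg
      (Real.iSup_nonneg fun _ => abs_nonneg _) (Real.iSup_nonneg fun _ => abs_nonneg _))
    exact (abs_sub_le _ (g.1 x) _).trans
      (add_le_add (le_ciSup (bddAbove_range_abs_sub f g) x)
        (le_ciSup (bddAbove_range_abs_sub g h) x))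
  eq_of_dist_eq_zero {f g} h := by
    refine Subtype.ext (funext fun x => ?_)
    have := (le_ciSup (bddAbove_range_abs_sub f g) x).trans_eq h
    exact sub_eq_zero.1 (abs_eq_zero.1 (le_antisymm this (abs_nonneg _)))

end TightSpan

/-!
The isometry sends a point `q` of `closure (doubleHatch A)` to its distance function `dist q ·` on
`A`. Everything rests on a description of the double hatching by quadrants: if `A` is
path-connected, then `q ∈ doubleHatch A` if and only if each of the four closed axis-parallel
quadrants at `q` contains a point of `A` (`meetsQuadrants_of_mem_doubleHatch`,
`mem_doubleHatch_of_meetsQuadrants`).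

For such `q` and any point `p`, a point `b` of `A` in the quadrant at `q` opposite to `p` satisfies
`dist p q + dist q b = dist p b`. With `p` in `A` this makes `dist q ·` minimal; with `p` in the
closed double hatching it shows that the map preserves distances. Both pass to the closure with
arbitrarily small errors.

For surjectivity, a minimal `f` is bounded below by `dist p ·` for some `p` in the plane, because
the Manhattan plane is injective (`DominatesDist.exists_dist_le`), and so `f = dist p ·`. Minimality
provides each point of `A` with an almost opposite point of `A` as seen from `p`, and connectedness
of `A` then forces `A` to meet all four quadrants at `p`, enlarged by any `ε > 0`
(`meetsQuadrants_of_minimal_dist`). Again by connectedness, some point within `2 * ε` of `p` has all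
four exact quadrants met (`MeetsQuadrants.exists_dist_le`), so `p` lies in the closure.
-/

/-! ### The Manhattan plane and double hatching -/

theorem manhattan_dist_eq (p q : ManhattanPlane) :
    dist p q = |p.fst - q.fst| + |p.snd - q.snd| := by
  rw [WithLp.prod_dist_eq_of_L1, Real.dist_eq, Real.dist_eq]

/-- Hatching along the common fibres of a coordinate `f`, where the second coordinate `g` separates
the points of each fibre: a point is covered exactly if its fibre contains points of `A` on both
sides of it. -/
theorem mem_iUnion_convexHull_fiber_iff {f g : ManhattanPlane →ₗ[ℝ] ℝ}
    (hfg : ∀ p q, f p = f q → g p = g q → p = q) {A : Set ManhattanPlane} {q : ManhattanPlane} :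
    q ∈ ⋃ c : ℝ, convexHull ℝ {p | p ∈ A ∧ f p = c} ↔
      (∃ a ∈ A, f a = f q ∧ g a ≤ g q) ∧ ∃ b ∈ A, f b = f q ∧ g q ≤ g b := by
  constructor
  · intro h
    obtain ⟨c, hc⟩ := Set.mem_iUnion.1 h
    have lower : ∀ l : ManhattanPlane →ₗ[ℝ] ℝ, ∃ a, (a ∈ A ∧ f a = c) ∧ l a ≤ l q := fun l =>
      (l.concaveOn convex_univ).exists_le_of_mem_convexHull (Set.subset_univ _) hc
    have upper : ∀ l : ManhattanPlane →ₗ[ℝ] ℝ, ∃ a, (a ∈ A ∧ f a = c) ∧ l q ≤ l a := fun l =>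
      (l.convexOn convex_univ).exists_ge_of_mem_convexHull (Set.subset_univ _) hc
    have hq : f q = c := by
      obtain ⟨a, ⟨-, ha⟩, ha'⟩ := lower f
      obtain ⟨b, ⟨-, hb⟩, hb'⟩ := upper f
      linarith
    obtain ⟨a, ⟨ha, hac⟩, ha'⟩ := lower g
    obtain ⟨b, ⟨hb, hbc⟩, hb'⟩ := upper g
    exact ⟨⟨a, ha, hac.trans hq.symm, ha'⟩, b, hb, hbc.trans hq.symm, hb'⟩
  · rintro ⟨⟨a, ha, hac, hag⟩, b, hb, hbc, hbg⟩
    refine Set.mem_iUnion.2 ⟨f q, ?_⟩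
    have hgq : g q ∈ g.toAffineMap '' segment ℝ a b := by
      rw [image_segment]
      simpa [segment_eq_Icc (hag.trans hbg)] using And.intro hag hbg
    obtain ⟨r, hr, hrg⟩ := hgq
    have hrf : f r ∈ f.toAffineMap '' segment ℝ a b := ⟨r, hr, rfl⟩
    rw [image_segment] at hrf
    have hrf' : f r = f q := by simpa [hac, hbc] using hrf
    obtain rfl : r = q := hfg r q hrf' hrg
    exact segment_subset_convexHull (s := {p | p ∈ A ∧ f p = f r}) ⟨ha, hac⟩ ⟨hb, hbc⟩ hr

theorem mem_hatchY_iff {A : Set ManhattanPlane} {q : ManhattanPlane} :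
    q ∈ hatchY A ↔ (∃ a ∈ A, a.fst = q.fst ∧ a.snd ≤ q.snd) ∧
      ∃ b ∈ A, b.fst = q.fst ∧ q.snd ≤ b.snd :=
  mem_iUnion_convexHull_fiber_iff (f := WithLp.fstₗ 1 ℝ ℝ ℝ) (g := WithLp.sndₗ 1 ℝ ℝ ℝ)
    fun _ _ h₁ h₂ => WithLp.ofLp_injective 1 (Prod.ext h₁ h₂)

theorem mem_hatchX_iff {A : Set ManhattanPlane} {q : ManhattanPlane} :
    q ∈ hatchX A ↔ (∃ a ∈ A, a.snd = q.snd ∧ a.fst ≤ q.fst) ∧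
      ∃ b ∈ A, b.snd = q.snd ∧ q.fst ≤ b.fst :=
  mem_iUnion_convexHull_fiber_iff (f := WithLp.sndₗ 1 ℝ ℝ ℝ) (g := WithLp.fstₗ 1 ℝ ℝ ℝ)
    fun _ _ h₁ h₂ => WithLp.ofLp_injective 1 (Prod.ext h₂ h₁)

/-! ### Double hatching through quadrants -/

/-- Each of the four closed axis-parallel quadrants with apex `q`, enlarged by `ε` on both of its
sides, contains a point of `A`. For `ε = 0` these are the quadrants themselves. -/
def MeetsQuadrants (A : Set ManhattanPlane) (q : ManhattanPlane) (ε : ℝ) : Prop :=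
  (∃ a ∈ A, q.fst - ε ≤ a.fst ∧ q.snd - ε ≤ a.snd) ∧
  (∃ a ∈ A, q.fst - ε ≤ a.fst ∧ a.snd ≤ q.snd + ε) ∧
  (∃ a ∈ A, a.fst ≤ q.fst + ε ∧ q.snd - ε ≤ a.snd) ∧
  (∃ a ∈ A, a.fst ≤ q.fst + ε ∧ a.snd ≤ q.snd + ε)

theorem meetsQuadrants_of_mem_doubleHatch {A : Set ManhattanPlane} {q : ManhattanPlane}
    (hq : q ∈ doubleHatch A) : MeetsQuadrants A q 0 := by
  obtain ⟨⟨l, hl, hlq, hlq'⟩, r, hr, hrq, hrq'⟩ := mem_hatchX_iff.1 hq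
  obtain ⟨⟨a, ha, h₁, h₂⟩, b, hb, h₃, h₄⟩ := mem_hatchY_iff.1 hl
  obtain ⟨⟨c, hc, h₅, h₆⟩, d, hd, h₇, h₈⟩ := mem_hatchY_iff.1 hr
  exact ⟨⟨d, hd, by linarith, by linarith⟩, ⟨c, hc, by linarith, by linarith⟩,
    ⟨b, hb, by linarith, by linarith⟩, ⟨a, ha, by linarith, by linarith⟩⟩

/-- If a path-connected set has points `a`, `b` on both sides of the horizontal line at height `c`,
both on one side of a vertical line, then its vertical hatching meets the horizontal line on that
same side: follow a path from `b`, the farther of the two points, until it first reaches the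
abscissa of `a`. The sign of `σ` selects the side. -/
theorem exists_mem_hatchY_of_mem_uIcc {A : Set ManhattanPlane} (hA : IsPathConnected A)
    {σ : ℝ} (hσ : σ ≠ 0) {a b : ManhattanPlane} (ha : a ∈ A) (hb : b ∈ A)
    (hab : σ * a.fst ≤ σ * b.fst) {c : ℝ} (hc : c ∈ Set.uIcc a.snd b.snd) :
    ∃ r ∈ hatchY A, r.snd = c ∧ σ * a.fst ≤ σ * r.fst := by
  obtain ⟨γ, hγ⟩ := hA.joinedIn b hb a ha
  have hx : Continuous fun t => σ * (γ t).fst :=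
    continuous_const.mul ((WithLp.continuous_fst 1 ℝ ℝ).comp γ.continuous)
  have hy : Continuous fun t => (γ t).snd := (WithLp.continuous_snd 1 ℝ ℝ).comp γ.continuous
  obtain ⟨τ, hτ, hmin⟩ := (isClosed_le hx continuous_const :
    IsClosed {t | σ * (γ t).fst ≤ σ * a.fst}).isCompact.exists_isLeast ⟨1, by simp⟩
  have hbefore : ∀ t ≤ τ, σ * a.fst ≤ σ * (γ t).fst := by
    intro t ht
    by_contra! hlt
    -- The abscissa of `a` is reached between times `0` and `t ≤ τ`, but not before `τ`.
    obtain ⟨s, hs, hs'⟩ := intermediate_value_Icc' (unitInterval.nonneg' : 0 ≤ t)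
      hx.continuousOn ⟨hlt.le, by simpa using hab⟩
    have hst : s = t := le_antisymm hs.2 (ht.trans (hmin (le_of_eq hs')))
    rw [hst] at hs'
    exact hlt.ne hs'
  have hτa : (γ τ).fst = a.fst :=
    mul_left_cancel₀ hσ (le_antisymm hτ (hbefore τ le_rfl))
  by_cases hcτ : c ∈ Set.uIcc b.snd (γ τ).snd
  · -- The path crosses height `c` before time `τ`.
    obtain ⟨s, hs, hs'⟩ := intermediate_value_uIcc (a := (0 : unitInterval)) (b := τ)
      hy.continuousOn (by simpa using hcτ)
    rw [Set.uIcc_of_le (unitInterval.nonneg' : 0 ≤ τ)] at hs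
    exact ⟨γ s, mem_hatchY_iff.2 ⟨⟨γ s, hγ s, rfl, le_rfl⟩, γ s, hγ s, rfl, le_rfl⟩, hs',
      hbefore s hs.2⟩
  · -- Otherwise `γ τ` lies on the same side of the line as `b`, vertically opposite to `a`.
    refine ⟨WithLp.toLp 1 (a.fst, c), mem_hatchY_iff.2 ?_, rfl, le_rfl⟩
    simp only [Set.mem_uIcc, not_or, not_and, not_le] at hc hcτ
    rcases hc with hc | hc
    · refine ⟨⟨a, ha, rfl, hc.1⟩, γ τ, hγ τ, hτa, ?_⟩
      by_contra! h
      exact (hcτ.2 h.le).not_ge hc.2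
    · refine ⟨⟨γ τ, hγ τ, hτa, ?_⟩, a, ha, rfl, hc.2⟩
      by_contra! h
      exact (hcτ.1 hc.1).not_ge h.le

theorem mem_doubleHatch_of_meetsQuadrants {A : Set ManhattanPlane} (hA : IsPathConnected A)
    {q : ManhattanPlane} (hq : MeetsQuadrants A q 0) : q ∈ doubleHatch A := by
  have key : ∀ σ : ℝ, σ ≠ 0 → ∀ a ∈ A, ∀ b ∈ A, σ * q.fst ≤ σ * a.fst → σ * q.fst ≤ σ * b.fst →
      q.snd ∈ Set.uIcc a.snd b.snd → ∃ r ∈ hatchY A, r.snd = q.snd ∧ σ * q.fst ≤ σ * r.fst := by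
    intro σ hσ a ha b hb hqa hqb hc
    rcases le_total (σ * a.fst) (σ * b.fst) with hab | hab
    · obtain ⟨r, hr, hrq, har⟩ := exists_mem_hatchY_of_mem_uIcc hA hσ ha hb hab hc
      exact ⟨r, hr, hrq, hqa.trans har⟩
    · obtain ⟨r, hr, hrq, har⟩ :=
        exists_mem_hatchY_of_mem_uIcc hA hσ hb ha hab (Set.uIcc_comm a.snd b.snd ▸ hc)
      exact ⟨r, hr, hrq, hqb.trans har⟩
  simp only [MeetsQuadrants, sub_zero, add_zero] at hq
  obtain ⟨⟨a, ha, h₁, h₂⟩, ⟨b, hb, h₃, h₄⟩, ⟨c, hc, h₅, h₆⟩, d, hd, h₇, h₈⟩ := hq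
  refine mem_hatchX_iff.2 ⟨?_, ?_⟩
  · obtain ⟨r, hr, hrq, h⟩ := key (-1) (by norm_num) c hc d hd (by linarith) (by linarith)
      (Set.mem_uIcc.2 (Or.inr ⟨h₈, h₆⟩))
    exact ⟨r, hr, hrq, by linarith⟩
  · obtain ⟨r, hr, hrq, h⟩ := key 1 one_ne_zero a ha b hb (by linarith) (by linarith)
      (Set.mem_uIcc.2 (Or.inr ⟨h₄, h₂⟩))
    exact ⟨r, hr, hrq, by linarith⟩

/-- For a connected set, enlarged quadrants can be traded for a nearby apex. The two coordinates of
the new apex are found one after the other: connectedness gives a point of `A` with a prescribed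
ordinate (respectively abscissa), and its other coordinate is clamped to the `ε`-box around `q`. -/
theorem MeetsQuadrants.exists_dist_le {A : Set ManhattanPlane} (hA : IsPreconnected A)
    {q : ManhattanPlane} {ε : ℝ} (hε : 0 ≤ ε) (hq : MeetsQuadrants A q ε) :
    ∃ q', dist q q' ≤ 2 * ε ∧ MeetsQuadrants A q' 0 := by
  have hX := (hA.image _ (WithLp.continuous_fst 1 ℝ ℝ).continuousOn).ordConnected
  have hY := (hA.image _ (WithLp.continuous_snd 1 ℝ ℝ).continuousOn).ordConnected
  obtain ⟨⟨a, ha, h₁, h₂⟩, ⟨b, hb, h₃, h₄⟩, ⟨c, hc, h₅, h₆⟩, d, hd, h₇, h₈⟩ := hq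
  obtain ⟨e, he, he₁, he₂⟩ : ∃ e ∈ A, q.snd - ε ≤ e.snd ∧ e.snd ≤ q.snd + ε := by
    by_cases had : q.snd + ε ≤ a.snd
    · obtain ⟨e, he, hey⟩ := hY.out ⟨d, hd, rfl⟩ ⟨a, ha, rfl⟩ ⟨h₈, had⟩
      exact ⟨e, he, by linarith, by linarith⟩
    · exact ⟨a, ha, h₂, by linarith⟩
  obtain ⟨x, hx₁, hx₂, ha', hb', hc', hd'⟩ : ∃ x, q.fst - ε ≤ x ∧ x ≤ q.fst + ε ∧
      (∃ a ∈ A, x ≤ a.fst ∧ q.snd - ε ≤ a.snd) ∧ (∃ a ∈ A, x ≤ a.fst ∧ a.snd ≤ q.snd + ε) ∧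
      (∃ a ∈ A, a.fst ≤ x ∧ q.snd - ε ≤ a.snd) ∧ (∃ a ∈ A, a.fst ≤ x ∧ a.snd ≤ q.snd + ε) := by
    rcases lt_or_ge e.fst (q.fst - ε) with h | h
    · exact ⟨q.fst - ε, le_rfl, by linarith, ⟨a, ha, h₁, h₂⟩, ⟨b, hb, h₃, h₄⟩,
        ⟨e, he, h.le, he₁⟩, ⟨e, he, h.le, he₂⟩⟩
    rcases lt_or_ge (q.fst + ε) e.fst with h' | h'
    · exact ⟨q.fst + ε, by linarith, le_rfl, ⟨e, he, h'.le, he₁⟩, ⟨e, he, h'.le, he₂⟩,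
        ⟨c, hc, h₅, h₆⟩, ⟨d, hd, h₇, h₈⟩⟩
    · exact ⟨e.fst, h, h', ⟨e, he, le_rfl, he₁⟩, ⟨e, he, le_rfl, he₂⟩, ⟨e, he, le_rfl, he₁⟩,
        ⟨e, he, le_rfl, he₂⟩⟩
  obtain ⟨a, ha, h₁, h₂⟩ := ha'
  obtain ⟨b, hb, h₃, h₄⟩ := hb'
  obtain ⟨c, hc, h₅, h₆⟩ := hc'
  obtain ⟨d, hd, h₇, h₈⟩ := hd'
  obtain ⟨e, he, hex⟩ := hX.out ⟨d, hd, rfl⟩ ⟨a, ha, rfl⟩ ⟨h₇, h₁⟩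
  replace hex : e.fst = x := hex
  suffices H : ∃ y, q.snd - ε ≤ y ∧ y ≤ q.snd + ε ∧
      (∃ a ∈ A, x ≤ a.fst ∧ y ≤ a.snd) ∧ (∃ a ∈ A, x ≤ a.fst ∧ a.snd ≤ y) ∧
      (∃ a ∈ A, a.fst ≤ x ∧ y ≤ a.snd) ∧ (∃ a ∈ A, a.fst ≤ x ∧ a.snd ≤ y) by
    obtain ⟨y, hy₁, hy₂, H⟩ := H
    refine ⟨WithLp.toLp 1 (x, y), ?_, by simpa [MeetsQuadrants] using H⟩
    rw [manhattan_dist_eq]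
    have h₁ : |q.fst - x| ≤ ε := abs_le.2 ⟨by linarith, by linarith⟩
    have h₂ : |q.snd - y| ≤ ε := abs_le.2 ⟨by linarith, by linarith⟩
    change |q.fst - x| + |q.snd - y| ≤ 2 * ε
    linarith
  rcases lt_or_ge e.snd (q.snd - ε) with h | h
  · exact ⟨q.snd - ε, le_rfl, by linarith, ⟨a, ha, h₁, h₂⟩, ⟨e, he, hex.ge, h.le⟩,
      ⟨c, hc, h₅, h₆⟩, ⟨e, he, hex.le, h.le⟩⟩
  rcases lt_or_ge (q.snd + ε) e.snd with h' | h'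
  · exact ⟨q.snd + ε, by linarith, le_rfl, ⟨e, he, hex.ge, h'.le⟩, ⟨b, hb, h₃, h₄⟩,
      ⟨e, he, hex.le, h'.le⟩, ⟨d, hd, h₇, h₈⟩⟩
  · exact ⟨e.snd, h, h', ⟨e, he, hex.ge, le_rfl⟩, ⟨e, he, hex.ge, le_rfl⟩,
      ⟨e, he, hex.le, le_rfl⟩, ⟨e, he, hex.le, le_rfl⟩⟩

/-- Whenever `A` meets the quadrants at `q`, every point `p` can be continued through `q` to a point
of `A` along a geodesic: take a point of `A` in the quadrant at `q` opposite to `p`. -/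
theorem MeetsQuadrants.exists_dist_add_eq {A : Set ManhattanPlane} {q : ManhattanPlane}
    (hq : MeetsQuadrants A q 0) (p : ManhattanPlane) :
    ∃ b ∈ A, dist p q + dist q b = dist p b := by
  have add_abs : ∀ {x y z : ℝ}, x ≤ y ∧ y ≤ z ∨ z ≤ y ∧ y ≤ x →
      |x - y| + |y - z| = |x - z| := by
    rintro x y z (⟨h, h'⟩ | ⟨h, h'⟩)
    · rw [abs_of_nonpos (by linarith), abs_of_nonpos (by linarith),
        abs_of_nonpos (by linarith)]; ring
    · rw [abs_of_nonneg (by linarith), abs_of_nonneg (by linarith),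
        abs_of_nonneg (by linarith)]; ring
  simp only [MeetsQuadrants, sub_zero, add_zero] at hq
  obtain ⟨⟨a, ha, h₁, h₂⟩, ⟨b, hb, h₃, h₄⟩, ⟨c, hc, h₅, h₆⟩, d, hd, h₇, h₈⟩ := hq
  have key : ∀ r : ManhattanPlane,
      (p.fst ≤ q.fst ∧ q.fst ≤ r.fst ∨ r.fst ≤ q.fst ∧ q.fst ≤ p.fst) →
      (p.snd ≤ q.snd ∧ q.snd ≤ r.snd ∨ r.snd ≤ q.snd ∧ q.snd ≤ p.snd) →
      dist p q + dist q r = dist p r := by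
    intro r hx hy
    simp only [manhattan_dist_eq, ← add_abs hx, ← add_abs hy]
    ring
  rcases le_total p.fst q.fst with hx | hx <;> rcases le_total p.snd q.snd with hy | hy
  · exact ⟨a, ha, key a (Or.inl ⟨hx, h₁⟩) (Or.inl ⟨hy, h₂⟩)⟩
  · exact ⟨b, hb, key b (Or.inl ⟨hx, h₃⟩) (Or.inr ⟨h₄, hy⟩)⟩
  · exact ⟨c, hc, key c (Or.inr ⟨h₅, hx⟩) (Or.inl ⟨hy, h₆⟩)⟩
  · exact ⟨d, hd, key d (Or.inr ⟨h₇, hx⟩) (Or.inr ⟨h₈, hy⟩)⟩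

theorem exists_dist_add_le_of_mem_closure_doubleHatch {A : Set ManhattanPlane}
    {q : ManhattanPlane} (hq : q ∈ closure (doubleHatch A)) (p : ManhattanPlane) {ε : ℝ}
    (hε : 0 < ε) : ∃ b ∈ A, dist p q + dist q b ≤ dist p b + ε := by
  obtain ⟨q', hq', hd⟩ := Metric.mem_closure_iff.1 hq (ε / 2) (half_pos hε)
  obtain ⟨b, hb, h⟩ := (meetsQuadrants_of_mem_doubleHatch hq').exists_dist_add_eq p
  refine ⟨b, hb, ?_⟩
  have h₁ := dist_triangle p q' q
  have h₂ := dist_triangle q q' b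
  rw [dist_comm q' q] at h₁
  linarith

/-! ### Minimal functions -/

/-- A function dominating the distance is minimal exactly if each of its values is, up to arbitrarily
small errors, forced by its value at some point (possibly the same one). -/
theorem minimal_dominatesDist_iff {X : Type*} [MetricSpace X] {f : X → ℝ} :
    Minimal DominatesDist f ↔
      DominatesDist f ∧ ∀ x, ∀ ε > 0, ∃ y, f x + f y ≤ dist x y + ε := by
  classical
  constructor
  · intro hf
    refine ⟨hf.prop, fun x ε hε => ?_⟩
    by_contra! h
    -- Lowering the value at `x` by `ε / 2` keeps all the constraints, the one for `(x, x)` included.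
    have hx : ε < f x + f x := by simpa using h x
    have hg : DominatesDist (Function.update f x (f x - ε / 2)) := by
      refine ⟨fun z => ?_, fun z w => ?_⟩
      · rcases eq_or_ne z x with rfl | hz
        · rw [Function.update_self]; linarith
        · rw [Function.update_of_ne hz]; exact hf.prop.1 z
      · rcases eq_or_ne z x with rfl | hz <;> rcases eq_or_ne w z with rfl | hw
        · rw [Function.update_self, dist_self]; linarith
        · rw [Function.update_self, Function.update_of_ne hw]; linarith [h w]
        · rw [Function.update_of_ne hz]; exact hf.prop.2 w w
        · rcases eq_or_ne w x with rfl | hw'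
          · rw [Function.update_self, Function.update_of_ne hz, dist_comm]; linarith [h z]
          · rw [Function.update_of_ne hz, Function.update_of_ne hw']; exact hf.prop.2 z w
    have hle : Function.update f x (f x - ε / 2) ≤ f :=
      update_le_iff.2 ⟨by linarith, fun _ _ => le_rfl⟩
    have := hf.le_of_le hg hle x
    rw [Function.update_self] at this
    linarith
  · rintro ⟨hf, h⟩
    refine ⟨hf, fun g hg hgf x => le_of_forall_pos_le_add fun ε hε => ?_⟩
    obtain ⟨y, hy⟩ := h x ε hε
    linarith [hg.2 x y, hgf y]

theorem dominatesDist_dist_restrict {X : Type*} [MetricSpace X] (A : Set X) (p : X) :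
    DominatesDist fun a : A => dist p a :=
  ⟨fun _ => dist_nonneg, fun x y => dist_triangle_left (x : X) y p⟩

theorem minimal_dist_of_mem_closure_doubleHatch {A : Set ManhattanPlane} {q : ManhattanPlane}
    (hq : q ∈ closure (doubleHatch A)) : Minimal DominatesDist fun a : A => dist q a := by
  refine minimal_dominatesDist_iff.2 ⟨dominatesDist_dist_restrict A q, fun a ε hε => ?_⟩
  obtain ⟨b, hb, h⟩ := exists_dist_add_le_of_mem_closure_doubleHatch hq a hε
  exact ⟨⟨b, hb⟩, by rwa [dist_comm q a]⟩

/-- Every function dominating the distance on a nonempty subset of the Manhattan plane dominates the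
distance to some point. The coordinates `x + y` and `x - y` turn the balls of the plane into
axis-parallel squares, and pairwise intersecting intervals have a common point. -/
theorem DominatesDist.exists_dist_le {A : Set ManhattanPlane} (hA : A.Nonempty) {f : A → ℝ}
    (hf : DominatesDist f) : ∃ p : ManhattanPlane, ∀ a : A, dist p a ≤ f a := by
  have : Nonempty A := hA.to_subtype
  have center : ∀ u : A → ℝ, (∀ a b, u a - u b ≤ f a + f b) →
      ∃ s, ∀ a, |s - u a| ≤ f a := by
    intro u hu
    have hbdd : ∀ b, ∀ a, u a - f a ≤ u b + f b := fun b a => by linarith [hu a b]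
    refine ⟨⨆ a, (u a - f a), fun a => abs_le.2 ⟨?_, ?_⟩⟩
    · linarith [le_ciSup (f := fun a => u a - f a)
        ⟨u a + f a, Set.forall_mem_range.2 (hbdd a)⟩ a]
    · linarith [ciSup_le (hbdd a)]
  have hd : ∀ a b : A, |a.1.fst - b.1.fst| + |a.1.snd - b.1.snd| ≤ f a + f b := fun a b => by
    rw [← manhattan_dist_eq]; exact hf.2 a b
  obtain ⟨s, hs⟩ := center (fun a => a.1.fst + a.1.snd) fun a b => by
    linarith [hd a b, le_abs_self (a.1.fst - b.1.fst), le_abs_self (a.1.snd - b.1.snd)]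
  obtain ⟨t, ht⟩ := center (fun a => a.1.fst - a.1.snd) fun a b => by
    linarith [hd a b, le_abs_self (a.1.fst - b.1.fst), neg_abs_le (a.1.snd - b.1.snd)]
  refine ⟨WithLp.toLp 1 ((s + t) / 2, (s - t) / 2), fun a => ?_⟩
  rw [manhattan_dist_eq]
  change |(s + t) / 2 - a.1.fst| + |(s - t) / 2 - a.1.snd| ≤ f a
  have h₁ := abs_le.1 (hs a)
  have h₂ := abs_le.1 (ht a)
  rcases abs_cases ((s + t) / 2 - a.1.fst) with ⟨h, -⟩ | ⟨h, -⟩ <;>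
  rcases abs_cases ((s - t) / 2 - a.1.snd) with ⟨h', -⟩ | ⟨h', -⟩ <;>
  rw [h, h'] <;> linarith

/-! ### Points with minimal distance function -/

/-- Let `A` be connected, and let each `a ∈ A` have a partner `b ∈ A` such that neither `u` nor `v`
is below `c` at both `a` and `b`. Then some point of `A` has both `u` and `v` at least `c`: otherwise
the open sets `u < c` and `v < c` cover `A` without a common point in `A`, so one of them contains
all of `A`, partners included. -/
theorem IsPreconnected.exists_le_and_le {X : Type*} [TopologicalSpace X] {A : Set X}
    (hA : IsPreconnected A) (hne : A.Nonempty) {u v : X → ℝ} (hu : Continuous u)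
    (hv : Continuous v) {c : ℝ}
    (h : ∀ a ∈ A, ∃ b ∈ A, (c ≤ u a ∨ c ≤ u b) ∧ (c ≤ v a ∨ c ≤ v b)) :
    ∃ a ∈ A, c ≤ u a ∧ c ≤ v a := by
  by_contra! H
  have hcover : A ⊆ {x | u x < c} ∪ {x | v x < c} := fun a ha => by
    by_cases hua : c ≤ u a
    · exact Or.inr (H a ha hua)
    · exact Or.inl (not_le.1 hua)
  have hdisj : A ∩ ({x | u x < c} ∩ {x | v x < c}) = ∅ := by
    refine Set.eq_empty_of_forall_notMem ?_
    rintro a ⟨ha, hua : u a < c, hva : v a < c⟩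
    obtain ⟨b, hb, hub, hvb⟩ := h a ha
    exact (H b hb (hub.resolve_left hua.not_ge)).not_ge (hvb.resolve_left hva.not_ge)
  obtain ⟨a, ha⟩ := hne
  obtain ⟨b, hb, hub, hvb⟩ := h a ha
  rcases isPreconnected_iff_subset_of_disjoint.1 hA _ _ (isOpen_lt hu continuous_const)
    (isOpen_lt hv continuous_const) hcover hdisj with hs | hs
  · exact hub.elim (not_le.2 (hs ha)) (not_le.2 (hs hb))
  · exact hvb.elim (not_le.2 (hs ha)) (not_le.2 (hs hb))

theorem meetsQuadrants_of_minimal_dist {A : Set ManhattanPlane} (hA : IsConnected A)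
    {p : ManhattanPlane} (hp : Minimal DominatesDist fun a : A => dist p a) {ε : ℝ} (hε : 0 < ε) :
    MeetsQuadrants A p ε := by
  have partner : ∀ a ∈ A, ∃ b ∈ A,
      |p.fst - a.fst| + |p.fst - b.fst| ≤ |a.fst - b.fst| + ε ∧
      |p.snd - a.snd| + |p.snd - b.snd| ≤ |a.snd - b.snd| + ε := by
    intro a ha
    obtain ⟨⟨b, hb⟩, h⟩ := (minimal_dominatesDist_iff.1 hp).2 ⟨a, ha⟩ ε hε
    simp only [Subtype.dist_eq, manhattan_dist_eq] at h
    have h₁ := abs_sub_le a.fst p.fst b.fst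
    have h₂ := abs_sub_le a.snd p.snd b.snd
    rw [abs_sub_comm a.fst p.fst] at h₁
    rw [abs_sub_comm a.snd p.snd] at h₂
    exact ⟨b, hb, by linarith, by linarith⟩
  -- If `s` and `t` lie on the same side of `x`, both farther than `ε`, the detour is over `2 * ε`.
  have above : ∀ {x s t : ℝ}, |x - s| + |x - t| ≤ |s - t| + ε →
      -ε ≤ s - x ∨ -ε ≤ t - x := by
    intro x s t h
    by_contra! H
    rw [abs_of_pos (by linarith), abs_of_pos (by linarith)] at h
    rcases abs_cases (s - t) with ⟨h', -⟩ | ⟨h', -⟩ <;> linarith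
  have below : ∀ {x s t : ℝ}, |x - s| + |x - t| ≤ |s - t| + ε →
      -ε ≤ x - s ∨ -ε ≤ x - t := by
    intro x s t h
    by_contra! H
    rw [abs_of_neg (by linarith), abs_of_neg (by linarith)] at h
    rcases abs_cases (s - t) with ⟨h', -⟩ | ⟨h', -⟩ <;> linarith
  have hx : Continuous fun a : ManhattanPlane => a.fst := WithLp.continuous_fst 1 ℝ ℝ
  have hy : Continuous fun a : ManhattanPlane => a.snd := WithLp.continuous_snd 1 ℝ ℝ
  have right : Continuous fun a : ManhattanPlane => a.fst - p.fst := hx.sub continuous_const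
  have left : Continuous fun a : ManhattanPlane => p.fst - a.fst := continuous_const.sub hx
  have up : Continuous fun a : ManhattanPlane => a.snd - p.snd := hy.sub continuous_const
  have down : Continuous fun a : ManhattanPlane => p.snd - a.snd := continuous_const.sub hy
  refine ⟨?_, ?_, ?_, ?_⟩
  · obtain ⟨a, ha, h₁, h₂⟩ := hA.isPreconnected.exists_le_and_le hA.nonempty right up
      fun a ha => (partner a ha).imp fun b ⟨hb, h₁, h₂⟩ => ⟨hb, above h₁, above h₂⟩
    exact ⟨a, ha, by linarith, by linarith⟩
  · obtain ⟨a, ha, h₁, h₂⟩ := hA.isPreconnected.exists_le_and_le hA.nonempty right down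
      fun a ha => (partner a ha).imp fun b ⟨hb, h₁, h₂⟩ => ⟨hb, above h₁, below h₂⟩
    exact ⟨a, ha, by linarith, by linarith⟩
  · obtain ⟨a, ha, h₁, h₂⟩ := hA.isPreconnected.exists_le_and_le hA.nonempty left up
      fun a ha => (partner a ha).imp fun b ⟨hb, h₁, h₂⟩ => ⟨hb, below h₁, above h₂⟩
    exact ⟨a, ha, by linarith, by linarith⟩
  · obtain ⟨a, ha, h₁, h₂⟩ := hA.isPreconnected.exists_le_and_le hA.nonempty left down
      fun a ha => (partner a ha).imp fun b ⟨hb, h₁, h₂⟩ => ⟨hb, below h₁, below h₂⟩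
    exact ⟨a, ha, by linarith, by linarith⟩

theorem mem_closure_doubleHatch_of_minimal_dist {A : Set ManhattanPlane} (hA : IsPathConnected A)
    {p : ManhattanPlane} (hp : Minimal DominatesDist fun a : A => dist p a) :
    p ∈ closure (doubleHatch A) := by
  refine Metric.mem_closure_iff.2 fun ε hε => ?_
  obtain ⟨q, hpq, hq⟩ := (meetsQuadrants_of_minimal_dist hA.isConnected hp
    (ε := ε / 3) (by positivity)).exists_dist_le hA.isConnected.isPreconnected (by positivity)
  exact ⟨q, mem_doubleHatch_of_meetsQuadrants hA hq, by linarith⟩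

/-! ### The isometry -/

/-- The map sending a point of the closed double hatching of `A` to its distance function on `A`. -/
noncomputable def closureDoubleHatchToTightSpan (A : Set ManhattanPlane)
    (q : closure (doubleHatch A)) : TightSpan A :=
  ⟨fun a => dist (q : ManhattanPlane) a, minimal_dist_of_mem_closure_doubleHatch q.2⟩

theorem isometry_closureDoubleHatchToTightSpan (A : Set ManhattanPlane) :
    Isometry (closureDoubleHatchToTightSpan A) := by
  refine Isometry.of_dist_eq fun p q => le_antisymm ?_ ?_
  · exact Real.iSup_le (fun a => abs_dist_sub_le (p : ManhattanPlane) q a) dist_nonneg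
  · refine le_of_forall_pos_le_add fun ε hε => ?_
    obtain ⟨b, hb, h⟩ := exists_dist_add_le_of_mem_closure_doubleHatch q.2 p hε
    have hsup : |dist (p : ManhattanPlane) b - dist (q : ManhattanPlane) b| ≤
        dist (closureDoubleHatchToTightSpan A p) (closureDoubleHatchToTightSpan A q) :=
      le_ciSup (TightSpan.bddAbove_range_abs_sub (closureDoubleHatchToTightSpan A p)
        (closureDoubleHatchToTightSpan A q)) (⟨b, hb⟩ : A)
    rw [Subtype.dist_eq]
    linarith [le_abs_self (dist (p : ManhattanPlane) b - dist (q : ManhattanPlane) b)]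

theorem surjective_closureDoubleHatchToTightSpan {A : Set ManhattanPlane}
    (hA : IsPathConnected A) : Function.Surjective (closureDoubleHatchToTightSpan A) := by
  rintro ⟨f, hf⟩
  obtain ⟨p, hp⟩ := hf.prop.exists_dist_le hA.nonempty
  obtain rfl : f = fun a : A => dist p a :=
    le_antisymm (hf.le_of_le (dominatesDist_dist_restrict A p) hp) hp
  exact ⟨⟨p, mem_closure_doubleHatch_of_minimal_dist hA hf⟩, rfl⟩

theorem theorem35 (A : Set ManhattanPlane) (hA : IsPathConnected A) :
    Nonempty (closure (doubleHatch A) ≃ᵢ TightSpan A) :=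
  ⟨⟨Equiv.ofBijective _ ⟨(isometry_closureDoubleHatchToTightSpan A).injective,
    surjective_closureDoubleHatchToTightSpan hA⟩, isometry_closureDoubleHatchToTightSpan A⟩⟩
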